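/- Let $X$ be a nonempty, separable, completely metrizable topological space in which every compact set has empty interior. Then there is a subset $M\subseteq X$ such that every finite power $M^m$ (with $M$ carrying the subspace topology and $M^m$ the product topology) has the Menger property, and $M$ is not contained in any $\sigma$-compact subset of $X$ (a subset that is a union of countably many compact sets). Here a space $Y$ has the Menger property if for every sequence $\mathcal U_1,\mathcal U_2,\ldots$ of open covers of $Y$ there are finite collections $\mathcal V_i\subseteq\mathcal U_i$ such that $\bigcup_i\mathcal V_i$ covers $Y$. -/

import Mathlib

/-- A topological space `Y` has the Menger property if, for every sequence `U 0, U 1, …` of open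
covers of `Y`, one can choose finite subfamilies `V i ⊆ U i` such that the sets belonging to the
families `V i`, over all `i`, cover `Y`. -/
def HasMengerProperty (Y : Type*) [TopologicalSpace Y] : Prop :=
  ∀ U : ℕ → Set (Set Y),
    (∀ i, (∀ u ∈ U i, IsOpen u) ∧ ⋃₀ U i = Set.univ) →
      ∃ V : ℕ → Set (Set Y),
        (∀ i, V i ⊆ U i ∧ (V i).Finite) ∧ (⋃ i, ⋃₀ V i) = Set.univ

open Set Filter Topology Cardinal

/-! A tree of closed balls gives a continuous `φ` from Baire space to `X` under which preimages of
compact sets are bounded. So it suffices to find `S ⊆ ℕ → ℕ`, unbounded modulo finite sets, with all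
finite powers Menger; then `M = φ '' S`. If some unbounded family is smaller than the dominating
number, its powers are Menger by cardinality. Otherwise there is a scale, and `S` consists of the
eventually zero sequences and sparse spiky sequences `x a` following the scale. One ultrafilter
makes any finitely many late `x a` have long zero blocks at the same places. -/

theorem HasMengerProperty.of_surjective {Y Z : Type*} [TopologicalSpace Y] [TopologicalSpace Z]
    (hY : HasMengerProperty Y) {f : Y → Z} (hf : Continuous f) (hs : Function.Surjective f) :
    HasMengerProperty Z := by
  intro U hU
  obtain ⟨V, hV, hVc⟩ := hY (fun i => (fun u => f ⁻¹' u) '' U i) (by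
    intro i
    refine ⟨?_, ?_⟩
    · rintro _ ⟨u, hu, rfl⟩
      exact ((hU i).1 u hu).preimage hf
    · rw [eq_univ_iff_forall]
      intro y
      have : f y ∈ ⋃₀ U i := by rw [(hU i).2]; trivial
      obtain ⟨u, hu, hyu⟩ := this
      exact ⟨f ⁻¹' u, ⟨u, hu, rfl⟩, hyu⟩)
  have hpre : Function.Injective (fun u : Set Z => f ⁻¹' u) := hs.preimage_injective
  refine ⟨fun i => (fun u => f ⁻¹' u) ⁻¹' V i, fun i => ⟨?_, (hV i).2.preimage hpre.injOn⟩, ?_⟩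
  · intro u hu
    obtain ⟨u', hu', h⟩ := (hV i).1 hu
    exact hpre h ▸ hu'
  · rw [eq_univ_iff_forall]
    intro z
    obtain ⟨y, rfl⟩ := hs z
    have : y ∈ ⋃ i, ⋃₀ V i := by rw [hVc]; trivial
    obtain ⟨i, v, hv, hyv⟩ := mem_iUnion.1 this
    obtain ⟨u, hu, rfl⟩ := (hV i).1 hv
    exact mem_iUnion.2 ⟨i, u, hv, hyv⟩

/-- In a second countable space it suffices to diagonalize against increasing countable covers. -/
theorem HasMengerProperty.of_monotone {Y : Type*} [TopologicalSpace Y]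
    [SecondCountableTopology Y]
    (h : ∀ W : ℕ → ℕ → Set Y, (∀ n k, IsOpen (W n k)) → (∀ n, Monotone (W n)) →
      (∀ n y, ∃ k, y ∈ W n k) → ∃ b : ℕ → ℕ, ∀ y, ∃ n, y ∈ W n (b n)) :
    HasMengerProperty Y := by
  intro U hU
  rcases isEmpty_or_nonempty Y with hY | hY
  · exact ⟨fun _ => ∅, fun i => ⟨empty_subset _, finite_empty⟩, Subsingleton.elim _ _⟩
  have key : ∀ i, ∃ c : ℕ → Set Y, (∀ j, c j ∈ U i) ∧ ∀ y, ∃ j, y ∈ c j := by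
    intro i
    obtain ⟨T, hTc, hTU, hT⟩ := TopologicalSpace.isOpen_sUnion_countable (U i) (hU i).1
    rw [(hU i).2] at hT
    have hne : T.Nonempty := by
      obtain ⟨y⟩ := hY
      have : y ∈ ⋃₀ T := by rw [hT]; trivial
      obtain ⟨t, ht, -⟩ := this
      exact ⟨t, ht⟩
    obtain ⟨c, rfl⟩ := hTc.exists_eq_range hne
    refine ⟨c, fun j => hTU (mem_range_self j), fun y => ?_⟩
    have : y ∈ ⋃₀ range c := by rw [hT]; trivial
    simpa using this
  choose c hcU hc using key
  obtain ⟨b, hb⟩ := h (fun n k => ⋃ j ∈ Iic k, c n j)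
    (fun n k => isOpen_biUnion fun j _ => (hU n).1 _ (hcU n j))
    (fun n k l hkl => biUnion_subset_biUnion_left (Iic_subset_Iic.2 hkl))
    (fun n y => by
      obtain ⟨j, hj⟩ := hc n y
      exact ⟨j, mem_biUnion (mem_Iic.2 le_rfl) hj⟩)
  refine ⟨fun n => c n '' Iic (b n), fun n => ⟨?_, (finite_Iic _).image _⟩, ?_⟩
  · rintro _ ⟨j, -, rfl⟩
    exact hcU n j
  · rw [eq_univ_iff_forall]
    intro y
    obtain ⟨n, hn⟩ := hb y
    obtain ⟨j, hj, hy⟩ := mem_iUnion₂.1 hn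
    exact mem_iUnion.2 ⟨n, c n j, mem_image_of_mem _ hj, hy⟩

/-! ### Sets smaller than the dominating number -/

/-- A family of functions dominating every function modulo finite sets. -/
def IsDominating (D : Set (ℕ → ℕ)) : Prop := ∀ g : ℕ → ℕ, ∃ f ∈ D, g ≤ᶠ[atTop] f

/-- The dominating number. -/
noncomputable def dominatingNumber : Cardinal.{0} :=
  sInf ((fun D : Set (ℕ → ℕ) => #D) '' {D | IsDominating D})

theorem exists_isDominating_mk_eq : ∃ D, IsDominating D ∧ #D = dominatingNumber := by
  have hne : ((fun D : Set (ℕ → ℕ) => #D) '' {D | IsDominating D}).Nonempty :=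
    ⟨_, univ, fun g => ⟨g, mem_univ _, EventuallyLE.refl _ _⟩, rfl⟩
  exact csInf_mem hne

theorem aleph0_le_dominatingNumber : ℵ₀ ≤ dominatingNumber := by
  obtain ⟨D, hD, hc⟩ := exists_isDominating_mk_eq
  by_contra! h
  rw [← hc, lt_aleph0_iff_set_finite] at h
  obtain ⟨f, hf, hgf⟩ := hD (fun n => ∑ f ∈ h.toFinset, f n + 1)
  obtain ⟨n, hn⟩ := hgf.exists
  have := Finset.single_le_sum (f := fun f : ℕ → ℕ => f n) (fun _ _ => Nat.zero_le _)
    (h.mem_toFinset.2 hf)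
  simp only at hn this
  omega

theorem exists_frequently_lt_of_mk_lt {ι : Type} (hι : #ι < dominatingNumber)
    (h : ι → ℕ → ℕ) : ∃ g : ℕ → ℕ, ∀ i, ∃ᶠ n in atTop, h i n < g n := by
  by_contra! hg
  have hD : IsDominating (range h) := by
    intro g
    obtain ⟨i, hi⟩ := hg g
    exact ⟨h i, mem_range_self i, by simpa [EventuallyLE] using hi⟩
  exact (mk_range_le.trans_lt hι).not_ge (csInf_le' ⟨_, hD, rfl⟩)

/-- Each point yields the function of indices at which the covers catch it; so few functions cannot
dominate, and a `g` escaping them all picks the covers. -/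
theorem hasMengerProperty_pi_of_mk_lt {B : Set (ℕ → ℕ)} (hB : #B < dominatingNumber) (m : ℕ) :
    HasMengerProperty (Fin m → B) := by
  have hc : #(Fin m → B) < dominatingNumber := by
    rw [← power_def, mk_fin]
    rcases lt_or_ge #B ℵ₀ with h | h
    · exact (power_lt_aleph0 h natCast_lt_aleph0).trans_le aleph0_le_dominatingNumber
    · exact (power_nat_le h).trans_lt hB
  refine .of_monotone fun W _ hW hc' => ?_
  choose k hk using hc'
  obtain ⟨g, hg⟩ := exists_frequently_lt_of_mk_lt hc (fun y n => k n y)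
  refine ⟨g, fun y => ?_⟩
  obtain ⟨n, hn⟩ := (hg y).exists
  exact ⟨n, hW n hn.le (hk n y)⟩

/-! ### Sets concentrated on the eventually zero sequences -/

/-- `x` is bounded by `n` below `n` and vanishes on `[n, g n)`. -/
def VanishesAfter (g x : ℕ → ℕ) (n : ℕ) : Prop :=
  (∀ i < n, x i ≤ n) ∧ ∀ i, n ≤ i → i < g n → x i = 0

/-- Cut `ℕ` into intervals `[k i, k (i + 1))` growing faster than `g`. The ultrafilter chooses a
class `c` of indices mod 3, and the spikes sit at `k i` with `i ≡ c - 1`. From `n` in an interval of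
class `c`, the last spike has height at most `n`, and the next lies a whole interval further on,
beyond `g n`. -/
theorem exists_vanishesAfter_of_ultrafilter (U : Ultrafilter ℕ) (g : ℕ → ℕ) :
    ∃ x : ℕ → ℕ, (∀ᶠ n in (U : Filter ℕ), VanishesAfter g x n) ∧
      ∃ᶠ n in atTop, g n < x n := by
  classical
  let G : ℕ → ℕ := fun n => n + 1 + ∑ j ∈ Finset.range (n + 1), g j
  have hG : ∀ n j, j ≤ n → g j < G n := fun n j hj => by
    have := Finset.single_le_sum (f := g) (fun _ _ => Nat.zero_le _)
      (Finset.mem_range.2 (show j < n + 1 by omega))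
    simp only [G]
    omega
  let k : ℕ → ℕ := fun i => G^[i] 0
  have hk : ∀ i, k (i + 1) = G (k i) := fun i => Function.iterate_succ_apply' _ _ _
  have hmono : StrictMono k := strictMono_nat_of_lt_succ fun i => by
    rw [hk]
    simp only [G]
    omega
  have hcover : ∀ n, ∃ i, k i ≤ n ∧ n < k (i + 1) := by
    intro n
    have hex : ∃ i, n < k i := ⟨n + 1, (Nat.lt_succ_self n).trans_le hmono.le_apply⟩
    obtain ⟨i, hi⟩ : ∃ i, Nat.find hex = i + 1 := by
      refine Nat.exists_eq_succ_of_ne_zero fun h => ?_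
      have := Nat.find_spec hex
      rw [h] at this
      exact Nat.not_lt_zero _ this
    refine ⟨i, not_lt.1 (Nat.find_min hex (by omega)), hi ▸ Nat.find_spec hex⟩
  have hres : ∃ c < 3, ∀ᶠ n in (U : Filter ℕ), ∃ i, i % 3 = c ∧ k i ≤ n ∧ n < k (i + 1) := by
    have : ∀ᶠ n in (U : Filter ℕ), (∃ i, i % 3 = 0 ∧ k i ≤ n ∧ n < k (i + 1)) ∨
        (∃ i, i % 3 = 1 ∧ k i ≤ n ∧ n < k (i + 1)) ∨
        (∃ i, i % 3 = 2 ∧ k i ≤ n ∧ n < k (i + 1)) := by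
      refine Eventually.of_forall fun n => ?_
      obtain ⟨i, hi⟩ := hcover n
      have : i % 3 = 0 ∨ i % 3 = 1 ∨ i % 3 = 2 := by omega
      rcases this with h | h | h
      · exact .inl ⟨i, h, hi⟩
      · exact .inr (.inl ⟨i, h, hi⟩)
      · exact .inr (.inr ⟨i, h, hi⟩)
    rw [Ultrafilter.eventually_or, Ultrafilter.eventually_or] at this
    rcases this with h | h | h
    exacts [⟨0, by norm_num, h⟩, ⟨1, by norm_num, h⟩, ⟨2, by norm_num, h⟩]
  obtain ⟨c, hc, hU⟩ := hres
  let x : ℕ → ℕ := fun j => if ∃ i, i % 3 = (c + 2) % 3 ∧ k i = j then G j else 0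
  have hx : ∀ i, i % 3 = (c + 2) % 3 → x (k i) = k (i + 1) := fun i hi => by
    rw [hk]
    exact if_pos ⟨i, hi, rfl⟩
  refine ⟨x, ?_, ?_⟩
  · filter_upwards [hU] with n ⟨i, hic, hin, hni⟩
    refine ⟨fun j hj => ?_, fun j hnj hj => ?_⟩
    · by_cases h : ∃ i, i % 3 = (c + 2) % 3 ∧ k i = j
      · obtain ⟨i', hi', rfl⟩ := h
        rw [hx i' hi']
        have := hmono.lt_iff_lt.1 (hj.trans hni)
        exact (hmono.monotone (show i' + 1 ≤ i by grind)).trans hin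
      · simp [x, h]
    · refine if_neg ?_
      rintro ⟨i', hi', rfl⟩
      have h1 := hmono.le_iff_le.1 (hin.trans hnj)
      have h2 : k i' < k (i + 2) := hj.trans ((hG _ _ hni.le).trans_eq (hk _).symm)
      have := hmono.lt_iff_lt.1 h2
      omega
  · rw [frequently_atTop]
    intro a
    refine ⟨k (3 * a + (c + 2) % 3), le_trans (by omega) hmono.le_apply, ?_⟩
    rw [hx _ (by omega), hk]
    exact hG _ _ le_rfl

theorem exists_initial_segment_subset {S : Set (ℕ → ℕ)} {m : ℕ} {W : Set (Fin m → S)}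
    (hW : IsOpen W) {p : Fin m → S} (hp : p ∈ W) :
    ∃ l, ∀ q : Fin m → S, (∀ i, ∀ j < l, (q i).1 j = (p i).1 j) → q ∈ W := by
  by_contra! h
  choose q hq hqW using h
  have : Tendsto q atTop (𝓝 p) := by
    refine tendsto_pi_nhds.2 fun i => tendsto_subtype_rng.2 (tendsto_pi_nhds.2 fun j => ?_)
    refine tendsto_const_nhds.congr' ?_
    filter_upwards [eventually_gt_atTop j] with l hl
    exact (hq l i j hl).symm
  obtain ⟨l, hl⟩ := (this.eventually (hW.mem_nhds hp)).exists
  exact hqW l hl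

/-- Open supersets of the eventually zero tuples contain all tuples with long enough blocks of
zeros. -/
theorem exists_vanishesAfter_imp_mem {S : Set (ℕ → ℕ)}
    (hS : ∀ q : ℕ → ℕ, (∀ᶠ n in atTop, q n = 0) → q ∈ S) {m : ℕ} (W : ℕ → Set (Fin m → S))
    (hWo : ∀ k, IsOpen (W k)) (hWm : Monotone W) (hW : ∀ p, ∃ k, p ∈ W k) (n : ℕ) :
    ∃ k l, ∀ q : Fin m → S, (∀ i, VanishesAfter (fun _ => l) (q i) n) → q ∈ W k := by
  -- Only finitely many tuples are bounded by `n` below `n` and zero afterwards, so one `k` and one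
  -- `l` serve all.
  let pt : (Fin m → Fin n → Fin (n + 1)) → Fin m → S := fun t i =>
    ⟨fun j => if h : j < n then t i ⟨j, h⟩ else 0, hS _ (by
      filter_upwards [eventually_ge_atTop n] with j hj
      exact dif_neg hj.not_gt)⟩
  choose k hk using fun t => hW (pt t)
  obtain ⟨K, hK⟩ := Finite.exists_le k
  choose l hl using fun t => exists_initial_segment_subset (hWo K) (hWm (hK t) (hk t))
  obtain ⟨L, hL⟩ := Finite.exists_le l
  refine ⟨K, L, fun q hq => ?_⟩
  refine hl (fun i j => ⟨(q i).1 j, Nat.lt_succ_of_le ((hq i).1 j j.2)⟩) q fun i j hj => ?_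
  by_cases h : j < n
  · simp [pt, h]
  · simp only [pt, h, dif_neg, not_false_eq_true]
    exact (hq i).2 j (not_lt.1 h) (hj.trans_le (hL _))

/-- Powers of a set concentrated, in the sense of an ultrafilter, on the eventually zero
sequences satisfy a strong form of the Menger property. -/
theorem exists_eventually_mem_of_concentrated (U : Ultrafilter ℕ) (hU : (U : Filter ℕ) ≤ atTop)
    {ι : Type} [LinearOrder ι] (x : ι → ℕ → ℕ)
    (hx : ∀ g, ∃ a, ∀ b, a ≤ b → ∀ᶠ n in (U : Filter ℕ), VanishesAfter g (x b) n)
    (hb : ∀ (a : ι) (h : Iio a → ℕ → ℕ), ∃ g, ∀ b, h b ≤ᶠ[atTop] g)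
    {S : Set (ℕ → ℕ)} (hS : S = {q | ∀ᶠ n in atTop, q n = 0} ∪ range x) (m : ℕ)
    (W : ℕ → ℕ → Set (Fin m → S)) (hWo : ∀ n k, IsOpen (W n k)) (hWm : ∀ n, Monotone (W n))
    (hW : ∀ n p, ∃ k, p ∈ W n k) :
    ∃ h : ℕ → ℕ, ∀ p, ∀ᶠ n in (U : Filter ℕ), p ∈ W n (h n) := by
  have hQS : ∀ q : ℕ → ℕ, (∀ᶠ n in atTop, q n = 0) → q ∈ S := fun q hq => hS ▸ .inl hq
  have main : ∀ (m : ℕ) (W : ℕ → ℕ → Set (Fin m → S)), (∀ n k, IsOpen (W n k)) →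
      (∀ n, Monotone (W n)) → (∀ n p, ∃ k, p ∈ W n k) → ∃ (h : ℕ → ℕ) (a : ι), ∀ p,
        (∀ i b, b < a → (p i).1 ≠ x b) → ∀ᶠ n in (U : Filter ℕ), p ∈ W n (h n) := by
    intro m W hWo hWm hW
    choose h l hl using fun n => exists_vanishesAfter_imp_mem hQS (W n) (hWo n) (hWm n) (hW n) n
    obtain ⟨a, ha⟩ := hx l
    refine ⟨h, a, fun p hp => ?_⟩
    have : ∀ᶠ n in (U : Filter ℕ), ∀ i, VanishesAfter l (p i) n := by
      refine eventually_all.2 fun i => ?_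
      have hpi : (p i).1 ∈ {q | ∀ᶠ n in atTop, q n = 0} ∪ range x := hS ▸ (p i).2
      rcases hpi with hq | ⟨b, hb⟩
      · obtain ⟨N, hN⟩ := eventually_atTop.1 hq
        refine hU ?_
        filter_upwards [eventually_ge_atTop N,
          eventually_ge_atTop (∑ j ∈ Finset.range N, (p i).1 j)] with n hn hn'
        refine ⟨fun j hj => ?_, fun j hj _ => hN j (hn.trans hj)⟩
        rcases lt_or_ge j N with hjN | hjN
        · exact (Finset.single_le_sum (f := (p i).1) (fun _ _ => Nat.zero_le _)
            (Finset.mem_range.2 hjN)).trans hn'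
        · simp [hN j hjN]
      · rw [← hb]
        exact ha b (not_lt.1 fun hlt => hp i b hlt hb.symm)
    filter_upwards [this] with n hn
    exact hl n p hn
  induction m with
  | zero =>
    obtain ⟨h, a, H⟩ := main 0 W hWo hWm hW
    exact ⟨h, fun p => H p fun i => i.elim0⟩
  | succ m ih =>
    obtain ⟨h, a, H⟩ := main _ W hWo hWm hW
    have hxS : ∀ b, x b ∈ S := fun b => hS ▸ .inr (mem_range_self b)
    -- Tuples with a coordinate `x b`, `b < a`, lie in slices homeomorphic to the `m`-th power; `hb`
    -- bounds the functions of all these slices at once.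
    have slice : ∀ (i : Fin (m + 1)) (b : ι), ∃ h : ℕ → ℕ, ∀ p : Fin m → S,
        ∀ᶠ n in (U : Filter ℕ), i.insertNth (α := fun _ => S) ⟨x b, hxS b⟩ p ∈ W n (h n) := by
      intro i b
      refine ih (fun n k => (fun p => i.insertNth (α := fun _ => S) ⟨x b, hxS b⟩ p) ⁻¹' W n k)
        (fun n k => (hWo n k).preimage ?_) (fun n k l hkl => preimage_mono (hWm n hkl))
        (fun n p => hW n _)
      exact Continuous.finInsertNth i continuous_const continuous_id
    choose s hs using slice
    choose t ht using fun i => hb a (fun b => s i b)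
    refine ⟨fun n => h n + ∑ i, t i n, fun p => ?_⟩
    by_cases hp : ∀ i b, b < a → (p i).1 ≠ x b
    · filter_upwards [H p hp] with n hn
      exact hWm n (Nat.le_add_right _ _) hn
    · push Not at hp
      obtain ⟨i, b, hba, hib⟩ := hp
      filter_upwards [hs i b (i.removeNth p), hU (ht i ⟨b, hba⟩)] with n hn hle
      have hpi : i.insertNth (α := fun _ => S) ⟨x b, hxS b⟩ (i.removeNth p) = p := by
        have : (⟨x b, hxS b⟩ : S) = p i := Subtype.ext hib.symm
        rw [this, Fin.insertNth_self_removeNth]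
      rw [hpi] at hn
      refine hWm n ?_ hn
      have := Finset.single_le_sum (f := fun i => t i n) (fun _ _ => Nat.zero_le _)
        (Finset.mem_univ i)
      exact (hle.trans this).trans (Nat.le_add_left _ _)

theorem exists_hasMengerProperty_pi_unbounded : ∃ S : Set (ℕ → ℕ),
    (∀ m : ℕ, HasMengerProperty (Fin m → S)) ∧ ∀ g : ℕ → ℕ, ∃ f ∈ S, ¬ f ≤ᶠ[atTop] g := by
  by_cases hB : ∃ B : Set (ℕ → ℕ), #B < dominatingNumber ∧ ∀ g, ∃ f ∈ B, ¬ f ≤ᶠ[atTop] g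
  · obtain ⟨B, hB, hub⟩ := hB
    exact ⟨B, hasMengerProperty_pi_of_mk_lt hB, hub⟩
  push Not at hB
  obtain ⟨D, hD, hDc⟩ := exists_isDominating_mk_eq
  -- In this order type every proper initial segment is smaller than the dominating number, hence
  -- bounded.
  let ι := dominatingNumber.ord.ToType
  obtain ⟨e⟩ : Nonempty (ι ≃ D) := Cardinal.eq.1 (by rw [hDc]; exact mk_ord_toType _)
  have hb : ∀ (a : ι) (h : Iio a → ℕ → ℕ), ∃ g, ∀ b, h b ≤ᶠ[atTop] g := by
    intro a h
    obtain ⟨g, hg⟩ := hB (range h) (mk_range_le.trans_lt (mk_Iio_toType_ord_lt a))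
    exact ⟨g, fun b => hg _ (mem_range_self b)⟩
  choose s hs using fun a : ι => hb a (fun b => (e b).1)
  let U : Ultrafilter ℕ := hyperfilter ℕ
  have hU : (U : Filter ℕ) ≤ atTop := Nat.hyperfilter_le_atTop
  choose x hxU hx using fun a => exists_vanishesAfter_of_ultrafilter U (fun n => s a n + (e a).1 n)
  have hdom : ∀ g : ℕ → ℕ, ∃ a, ∀ b, a ≤ b → g ≤ᶠ[atTop] fun n => s b n + (e b).1 n := by
    intro g
    obtain ⟨f, hf, hgf⟩ := hD g
    refine ⟨e.symm ⟨f, hf⟩, fun b hab => ?_⟩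
    rcases hab.eq_or_lt with rfl | hlt
    · filter_upwards [hgf] with n hn
      simp only [Equiv.apply_symm_apply]
      omega
    · filter_upwards [hgf, hs b ⟨_, hlt⟩] with n hn hn'
      simp only [Equiv.apply_symm_apply] at hn'
      omega
  refine ⟨{q | ∀ᶠ n in atTop, q n = 0} ∪ range x, fun m => ?_, fun g => ?_⟩
  · refine .of_monotone fun W hWo hWm hW => ?_
    obtain ⟨h, hh⟩ := exists_eventually_mem_of_concentrated U hU x (fun g => by
      obtain ⟨a, ha⟩ := hdom g
      refine ⟨a, fun b hab => ?_⟩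
      filter_upwards [hxU b, hU (ha b hab)] with n hn hle
      exact ⟨hn.1, fun i hi hig => hn.2 i hi (hig.trans_le hle)⟩) hb rfl m W hWo hWm hW
    exact ⟨h, fun y => (hh y).exists⟩
  · obtain ⟨a, ha⟩ := hdom g
    refine ⟨x a, .inr (mem_range_self a), fun hle => ?_⟩
    obtain ⟨n, hn, h1, h2⟩ := ((hx a).and_eventually (hle.and (ha a le_rfl))).exists
    exact (hn.trans_le h1).not_ge h2

/-! ### The map from Baire space -/

/-- Inside every ball of a complete metric space without compact neighbourhoods there is a
sequence of equally large balls such that every compact set meets only finitely many of them. -/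
theorem exists_seq_closedBall_finite_inter {X : Type*} [MetricSpace X] [CompleteSpace X]
    (hX : ∀ K : Set X, IsCompact K → interior K = ∅) (c : X) {r : ℝ} (hr : 0 < r) :
    ∃ (u : ℕ → X) (δ : ℝ), 0 < δ ∧ δ ≤ r / 2 ∧ (∀ n, dist (u n) c ≤ r) ∧
      (∀ n, Metric.closedBall (u n) δ ⊆ Metric.closedBall c r) ∧
      ∀ K : Set X, IsCompact K → {n | (Metric.closedBall (u n) δ ∩ K).Nonempty}.Finite := by
  have hnc : ¬ TotallyBounded (Metric.closedBall c (r / 2)) := fun htb => by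
    have hc := isCompact_iff_totallyBounded_isComplete.2
      ⟨htb, Metric.isClosed_closedBall.isComplete⟩
    have : c ∈ interior (Metric.closedBall c (r / 2)) :=
      Metric.ball_subset_interior_closedBall (Metric.mem_ball_self (half_pos hr))
    rw [hX _ hc] at this
    exact this
  rw [Metric.totallyBounded_iff] at hnc
  push Not at hnc
  obtain ⟨ε, hε, hnet⟩ := hnc
  obtain ⟨u, hu, hsep⟩ := exists_seq_of_forall_finset_exists
    (fun y => y ∈ Metric.closedBall c (r / 2)) (fun y z => ε ≤ dist z y) (fun s _ => by
      obtain ⟨y, hy, hys⟩ := not_subset.1 (hnet s s.finite_toSet)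
      refine ⟨y, hy, fun z hz => ?_⟩
      by_contra! hlt
      exact hys (mem_iUnion₂.2 ⟨z, hz, hlt⟩))
  have hsep' : ∀ m n, dist (u m) (u n) < ε → m = n := by
    intro m n hmn
    rcases lt_trichotomy m n with h | h | h
    · exact absurd (hsep m n h) (by rw [dist_comm]; exact hmn.not_ge)
    · exact h
    · exact absurd (hsep n m h) hmn.not_ge
  -- With radius `ε / 4`, balls meeting `K` near the same point of an `ε / 4`-net have centres less
  -- than `ε` apart, so they coincide.
  refine ⟨u, min (ε / 4) (r / 2), by positivity, min_le_right _ _, fun n => ?_, fun n => ?_,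
    fun K hK => ?_⟩
  · exact (Metric.mem_closedBall.1 (hu n)).trans (by linarith)
  · refine Metric.closedBall_subset_closedBall' ?_
    have := Metric.mem_closedBall.1 (hu n)
    have := min_le_right (ε / 4) (r / 2)
    linarith
  · obtain ⟨t, ht, hKt⟩ := Metric.totallyBounded_iff.1 hK.totallyBounded (ε / 4) (by positivity)
    have hch : ∀ n, (Metric.closedBall (u n) (min (ε / 4) (r / 2)) ∩ K).Nonempty →
        ∃ z ∈ t, dist (u n) z < ε / 2 := by
      rintro n ⟨y, hy, hyK⟩
      obtain ⟨z, hz, hyz⟩ := mem_iUnion₂.1 (hKt hyK)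
      refine ⟨z, hz, ?_⟩
      have h1 := Metric.mem_closedBall'.1 hy
      have h2 := Metric.mem_ball.1 hyz
      have := min_le_left (ε / 4) (r / 2)
      linarith [dist_triangle (u n) y z]
    have : Nonempty X := ⟨c⟩
    choose! z hzt hz using hch
    refine Finite.of_finite_image (f := z) (ht.subset ?_) ?_
    · rintro _ ⟨n, hn, rfl⟩
      exact hzt n hn
    · intro m hm n hn hmn
      refine hsep' m n ?_
      have h1 := hz m hm
      have h2 := hz n hn
      rw [← hmn] at h2
      linarith [dist_triangle_right (u m) (u n) (z m)]

/-- A nowhere locally compact complete metric space receives a continuous map from the Baire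
space under which preimages of compact sets are bounded. -/
theorem exists_continuous_bounded_preimage {X : Type*} [MetricSpace X] [CompleteSpace X]
    [Nonempty X] (hX : ∀ K : Set X, IsCompact K → interior K = ∅) :
    ∃ φ : (ℕ → ℕ) → X, Continuous φ ∧
      ∀ K : Set X, IsCompact K → ∃ b : ℕ → ℕ, ∀ f, φ f ∈ K → f ≤ b := by
  obtain ⟨x₀⟩ := ‹Nonempty X›
  choose u δ hδ hδr huc hsub hfin using
    fun s : X × {r : ℝ // 0 < r} => exists_seq_closedBall_finite_inter hX s.1 s.2.2
  let next : X × {r : ℝ // 0 < r} → ℕ → X × {r : ℝ // 0 < r} := fun s n => (u s n, ⟨δ s, hδ s⟩)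
  let node : (ℕ → ℕ) → ℕ → X × {r : ℝ // 0 < r} := fun f i =>
    Nat.rec (x₀, ⟨1, one_pos⟩) (fun i s => next s (f i)) i
  have hnode : ∀ f i, node f (i + 1) = next (node f i) (f i) := fun _ _ => rfl
  have hrad : ∀ f i, (node f i).2.1 ≤ (1 / 2 : ℝ) ^ i := by
    intro f i
    induction i with
    | zero => simp [node]
    | succ i ih =>
      have := hδr (node f i)
      rw [hnode, pow_succ]
      simp only [next]
      linarith
  have hcauchy : ∀ f, CauchySeq fun i => (node f i).1 := fun f =>
    cauchySeq_of_le_geometric (1 / 2) 1 (by norm_num) fun i => by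
      rw [one_mul, dist_comm]
      exact (huc (node f i) (f i)).trans (hrad f i)
  choose φ hφ using fun f => cauchySeq_tendsto_of_complete (hcauchy f)
  have hanti : ∀ f, Antitone fun i => Metric.closedBall (node f i).1 (node f i).2.1 := fun f =>
    antitone_nat_of_succ_le fun i => hsub (node f i) (f i)
  have hmem : ∀ f i, φ f ∈ Metric.closedBall (node f i).1 (node f i).2.1 := fun f i =>
    Metric.isClosed_closedBall.mem_of_tendsto (hφ f) <| by
      filter_upwards [eventually_ge_atTop i] with j hj
      exact hanti f hj (Metric.mem_closedBall_self (node f j).2.2.le)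
  refine ⟨φ, ?_, fun K hK => ?_⟩
  · have hloc : ∀ f i, ∀ᶠ g in 𝓝 f, node g i = node f i := by
      intro f i
      induction i with
      | zero => exact Eventually.of_forall fun _ => rfl
      | succ i ih =>
        have : ∀ᶠ g : ℕ → ℕ in 𝓝 f, g i = f i :=
          (continuous_apply i).continuousAt.eventually
            (mem_nhds_discrete.2 rfl : {n | n = f i} ∈ 𝓝 (f i))
        filter_upwards [ih, this] with g h1 h2
        rw [hnode, hnode, h1, h2]
    refine continuous_iff_continuousAt.2 fun f => Metric.tendsto_nhds.2 fun ε hε => ?_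
    obtain ⟨i, hi⟩ := exists_pow_lt_of_lt_one (half_pos hε) (show (1 / 2 : ℝ) < 1 by norm_num)
    filter_upwards [hloc f i] with g hg
    have h1 := Metric.mem_closedBall.1 (hmem f i)
    have h2 := Metric.mem_closedBall.1 (hmem g i)
    rw [hg] at h2
    have := hrad f i
    linarith [dist_triangle_right (φ g) (φ f) (node f i).1]
  -- The branches landing in `K` form a finitely branching subtree, so each level is finite and
  -- bounds the next coordinate.
  · let T : ℕ → Set (X × {r : ℝ // 0 < r}) := fun i => (fun f => node f i) '' (φ ⁻¹' K)
    let N : X × {r : ℝ // 0 < r} → Set ℕ := fun s =>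
      {n | (Metric.closedBall (u s n) (δ s) ∩ K).Nonempty}
    have hN : ∀ f i, φ f ∈ K → f i ∈ N (node f i) := fun f i hf => ⟨φ f, hmem f (i + 1), hf⟩
    have hT : ∀ i, (T i).Finite := by
      intro i
      induction i with
      | zero => exact (finite_singleton (x₀, ⟨1, one_pos⟩)).subset (by rintro _ ⟨f, -, rfl⟩; rfl)
      | succ i ih =>
        refine (ih.biUnion fun s _ => (hfin s K hK).image (next s)).subset ?_
        rintro _ ⟨f, hf, rfl⟩
        exact mem_biUnion (mem_image_of_mem _ hf) ⟨f i, hN f i hf, rfl⟩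
    choose b hb using fun i => ((hT i).biUnion fun s _ => hfin s K hK).bddAbove
    exact ⟨b, fun f hf i => hb i (mem_biUnion (mem_image_of_mem _ hf) (hN f i hf))⟩

theorem mainTheorem1 (X : Type*) [TopologicalSpace X] [TopologicalSpace.SeparableSpace X]
    [TopologicalSpace.IsCompletelyMetrizableSpace X] [Nonempty X]
    (hX : ∀ K : Set X, IsCompact K → interior K = ∅) :
    ∃ M : Set X, (∀ m : ℕ, HasMengerProperty (Fin m → M)) ∧
      ∀ K : Set X, IsSigmaCompact K → ¬ M ⊆ K := by
  let := TopologicalSpace.upgradeIsCompletelyMetrizable X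
  obtain ⟨φ, hφ, hK⟩ := exists_continuous_bounded_preimage hX
  obtain ⟨S, hS, hSu⟩ := exists_hasMengerProperty_pi_unbounded
  refine ⟨φ '' S, fun m => ?_, ?_⟩
  · let ψ : S → φ '' S := fun s => ⟨φ s, mem_image_of_mem _ s.2⟩
    have hψ : Continuous ψ := (hφ.comp continuous_subtype_val).subtype_mk _
    have hψs : Function.Surjective ψ := by
      rintro ⟨_, s, hs, rfl⟩
      exact ⟨⟨s, hs⟩, rfl⟩
    exact (hS m).of_surjective (f := fun p i => ψ (p i))
      (continuous_pi fun i => hψ.comp (continuous_apply i)) hψs.comp_left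
  · rintro _ ⟨C, hC, rfl⟩ hsub
    choose b hb using fun i => hK (C i) (hC i)
    -- From `n = i` on the sum contains `b i n`, so it eventually dominates every `b i`.
    obtain ⟨f, hf, hfb⟩ := hSu (fun n => ∑ i ∈ Finset.range (n + 1), b i n)
    obtain ⟨i, hi⟩ := mem_iUnion.1 (hsub (mem_image_of_mem φ hf))
    refine hfb ?_
    filter_upwards [eventually_ge_atTop i] with n hn
    exact (hb i f hi n).trans (Finset.single_le_sum (f := fun i => b i n)
      (fun _ _ => Nat.zero_le _) (Finset.mem_range.2 (Nat.lt_succ_of_le hn)))
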